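/- Let $p$ be a prime and let $a,b$ be integers with $0\le b\le a$, $a\ge 1$ and $a\equiv b \pmod{p-1}$. Let $S(n,k)$ denote the Stirling numbers of the second kind. For integers $c,d$ write $S(p^\infty a+c,\,p^\infty b+d)$ for the limit in $\mathbb{Z}_p$ of $S(p^e a+c,\,p^e b+d)$ as $e\to\infty$ and, similarly, $\binom{p^\infty\alpha+c}{p^\infty b+d}$ for the limit in $\mathbb{Z}_p$ of $\binom{p^e\alpha+c}{p^e b+d}$ as $e\to\infty$. For an integer $n$ and an integer $k\ge 0$ let $$T_p(n,k)=\frac{(-1)^k}{k!}\sum_{0\le i\le k,\ p\nmid i}(-1)^i\binom ki i^n\in\mathbb{Q}.$$ For integers $k\ge 1$ and $d\ge 0$ put $$Y(k,d)=S(p^\infty a+d-k,\;p^\infty b+d).$$ Then all the limits $Y(k,d)$ ($k\ge1$, $d\ge0$) exist in $\mathbb{Z}_p$, the limit $\binom{p^\infty\frac{pa-b}{p-1}-1}{p^\infty b}$ exists in $\mathbb{Z}_p$, and the following hold in $\mathbb{Q}_p$. 1. For all $d\ge 1$, $$Y(1,d)=T_p(d-1,d)\,\binom{p^\infty\frac{pa-b}{p-1}-1}{p^\infty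 b}.$$ 2. $Y(k,0)=0$ for all $k\ge 1$. 3. For all $k\ge 2$ and $d\ge 1$, $$Y(k,d)=\frac{Y(k-1,d)-Y(k-1,d-1)}{d}.$$ -/

import Mathlib

open Filter Topology

noncomputable section

namespace PadicStirling

/-- The Stirling number of the second kind `S(n, k)` for integers `n`, `k`, set to `0` when `n` or
`k` is negative. (In a limit `S(p^e a + c, p^e b + d)` with `a > 0` and `b, d ≥ 0`, both arguments
are nonnegative for all large `e`.) -/
def stirling (n k : ℤ) : ℕ :=
  if 0 ≤ n ∧ 0 ≤ k then Nat.stirlingSecond n.toNat k.toNat else 0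

/-- The binomial coefficient `n (n - 1) ⋯ (n - k + 1) / k!` for integers `n`, `k`, set to `0` when
`k` is negative. -/
def binom (n k : ℤ) : ℤ :=
  if 0 ≤ k then Ring.choose n k.toNat else 0

/-- The sequence `e ↦ S(p^e a + c, p^e b + d)` in `ℤ_p`. -/
def stirlingSeq (p : ℕ) [Fact p.Prime] (a c b d : ℤ) (e : ℕ) : ℤ_[p] :=
  (stirling ((p : ℤ) ^ e * a + c) ((p : ℤ) ^ e * b + d) : ℤ_[p])

/-- `S(p^∞ a + c, p^∞ b + d)`, the `p`-adic limit of `S(p^e a + c, p^e b + d)` as `e → ∞`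
(meaningful when that limit exists). -/
def stirlingLim (p : ℕ) [Fact p.Prime] (a c b d : ℤ) : ℤ_[p] :=
  limUnder atTop (stirlingSeq p a c b d)

/-- The sequence `e ↦ binom(p^e a + c, p^e b + d)` in `ℤ_p`. -/
def binomSeq (p : ℕ) [Fact p.Prime] (a c b d : ℤ) (e : ℕ) : ℤ_[p] :=
  (binom ((p : ℤ) ^ e * a + c) ((p : ℤ) ^ e * b + d) : ℤ_[p])

/-- `binom(p^∞ a + c, p^∞ b + d)`, the `p`-adic limit of `binom(p^e a + c, p^e b + d)` as `e → ∞`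
(meaningful when that limit exists). -/
def binomLim (p : ℕ) [Fact p.Prime] (a c b d : ℤ) : ℤ_[p] :=
  limUnder atTop (binomSeq p a c b d)

/-- The partial Stirling number
`T_p(n, k) = ((-1)^k / k!) ∑_{i ≢ 0 mod p} (-1)^i binom(k, i) i^n`, a rational number.
The terms with `i > k` vanish. -/
def partialStirling (p : ℕ) (n : ℤ) (k : ℕ) : ℚ :=
  (-1) ^ k / (k.factorial : ℚ) *
    ∑ i ∈ (Finset.range (k + 1)).filter (fun i => ¬ p ∣ i),
      (-1) ^ i * (k.choose i : ℚ) * (i : ℚ) ^ n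

/-- `Y(k, d) = S(p^∞ a + d - k, p^∞ b + d)`. -/
def Y (p : ℕ) [Fact p.Prime] (a b : ℤ) (k d : ℕ) : ℤ_[p] :=
  stirlingLim p a ((d : ℤ) - k) b d

end PadicStirling

end

/-!
Write `a = b + (p - 1) q`, so that `(p a - b) / (p - 1) = b + p q`. The statement follows from the
single formula

  `Y(k, d) = T_p(d - k, d) * binom(p^∞ (b + p q) - 1, p^∞ b)`   for all `k ≥ 1` and `d ≥ 0`

(`tendsto_stirling`): the value of `Y(1, d)` is a special case, `Y(k, 0)` vanishes because
`T_p(n, 0)` is an empty sum, and the recursion for `Y` is the recursion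
`T_p(n + 1, k + 1) = (k + 1) T_p(n, k + 1) + T_p(n, k)`.

To prove the formula, use the generating function `∑ S(m + k, k) x^m = ∏_{i=1}^k (1 - i x)⁻¹`. For
fixed `M` and large `e`, the product over a period of length `p^{e+1}` is congruent to
`(1 - x^{p-1})^{p^e}` modulo `p^M` (`pow_dvd_linProd_sub`). Comparing coefficients gives

  `S(p^{e+1} a + d - k, p^{e+1} b + d) ≡ ∑_{0 ≤ j < J} c_j S((p - 1)(J - j) + d - k, d)`

modulo `p^M`, where `J = p^{e+1} q` and `c_j = multichoose(p^e b, j)`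
(`pow_dvd_stirling_sub_sum`). Since `p^e` divides `j c_j`, the coefficient `c_j` is `p`-adically
small unless `j` is highly divisible by `p` (`norm_multichoose_le`). In that case the positive
number `J - j` is highly divisible by `p` too, and the explicit formula for Stirling numbers
together with Fermat's little theorem shows that `S((p - 1)(J - j) + d - k, d)` is close to
`T_p(d - k, d)` (`norm_stirling_sub_partialStirling_le`). So the sum is close to
`T_p(d - k, d) * ∑_{j < J} c_j = T_p(d - k, d) * binom(p^e (b + p q) - 1, p^e b)`, and these
binomial coefficients converge because `binom(p^{e+1} a, p^{e+1} b) ≡ binom(p^e a, p^e b)` modulo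
`p^{e+1}` (`pow_dvd_choose_sub`).
-/

namespace PadicStirling

/-! ### Generating functions of the Stirling numbers modulo prime powers -/

section GeneratingFunctions

open PowerSeries Finset

/-- The product `∏_{i=1}^n (1 - i x)` over a commutative ring. It is defined for an arbitrary
element `x`, and not only for a variable, so that it can be reduced modulo ideals. -/
def linProd {A : Type*} [CommRing A] (x : A) (n : ℕ) : A :=
  ∏ i ∈ range n, (1 - ((i + 1 : ℕ) : A) * x)

lemma map_linProd {A B : Type*} [CommRing A] [CommRing B] (f : A →+* B) (x : A) (n : ℕ) :
    f (linProd x n) = linProd (f x) n := by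
  simp [linProd, map_prod]

/-- The factors of `linProd` are periodic modulo `N`. -/
lemma linProd_mul_add {A : Type*} [CommRing A] (x : A) {N : ℕ} (hN : (N : A) = 0) (b d : ℕ) :
    linProd x (N * b + d) = linProd x N ^ b * linProd x d := by
  induction b with
  | zero => simp
  | succ b ih =>
    rw [show N * (b + 1) + d = N + (N * b + d) by ring, linProd, prod_range_add]
    have : ∏ i ∈ range (N * b + d), (1 - ((N + i + 1 : ℕ) : A) * x) = linProd x (N * b + d) := by
      simp [linProd, hN]
    rw [this, ih, ← linProd]
    ring

lemma linProd_mul {A : Type*} [CommRing A] (x : A) {N : ℕ} (hN : (N : A) = 0) (b : ℕ) :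
    linProd x (N * b) = linProd x N ^ b := by
  simpa [linProd] using linProd_mul_add x hN b 0

lemma prod_X_sub_C_zmod (p : ℕ) [Fact p.Prime] :
    ∏ a : ZMod p, (Polynomial.X - Polynomial.C a) = Polynomial.X ^ p - Polynomial.X := by
  have hp : 1 < p := (Fact.out : p.Prime).one_lt
  have h1 := FiniteField.roots_X_pow_card_sub_X (ZMod p)
  rw [ZMod.card] at h1
  have hdeg := FiniteField.X_pow_card_sub_X_natDegree_eq (ZMod p) hp
  have h2 := Polynomial.C_leadingCoeff_mul_prod_multiset_X_sub_C
    (p := (Polynomial.X ^ p - Polynomial.X : Polynomial (ZMod p)))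
    (by rw [h1, hdeg]; simp [ZMod.card])
  have h3 : (Polynomial.X ^ p - Polynomial.X : Polynomial (ZMod p)).leadingCoeff = 1 := by
    apply Polynomial.Monic.leadingCoeff
    exact Polynomial.monic_X_pow_sub (by simpa using hp)
  rw [h3, h1] at h2
  simpa using h2

/-- In characteristic `p` the `p` consecutive factors multiply to `1 - x^{p-1}`; this is the
factorization of `T^p - T` over `𝔽_p`, reversed. -/
lemma linProd_prime {A : Type*} [CommRing A] (p : ℕ) [Fact p.Prime] [CharP A p] (x : A) :
    linProd x p = 1 - x ^ (p - 1) := by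
  have hp : 0 < p := (Fact.out : p.Prime).pos
  let K := FractionRing (Polynomial (ZMod p))
  let t : K := algebraMap _ K (Polynomial.X : Polynomial (ZMod p))
  have ht : t ≠ 0 := by
    simp [t]
  -- the identity at `1 / T` in the fraction field of `𝔽_p[T]`, with denominators cleared
  have hK : ∏ a : ZMod p, (1 - algebraMap (ZMod p) K a * t) = 1 - t ^ (p - 1) := by
    have h := congrArg (Polynomial.aeval t⁻¹) (prod_X_sub_C_zmod p)
    simp only [map_prod, map_sub, Polynomial.aeval_X, Polynomial.aeval_C, map_pow] at h
    have h' : ∏ a : ZMod p, (1 - algebraMap (ZMod p) K a * t)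
        = t ^ p * ∏ a : ZMod p, (t⁻¹ - algebraMap (ZMod p) K a) := by
      conv_rhs => rw [show t ^ p = ∏ _a : ZMod p, t by simp [ZMod.card]]
      rw [← prod_mul_distrib]
      refine prod_congr rfl fun a _ => ?_
      rw [mul_sub, mul_inv_cancel₀ ht, mul_comm]
    rw [h', h, mul_sub, ← mul_pow, mul_inv_cancel₀ ht, one_pow]
    congr 1
    obtain ⟨q, rfl⟩ : ∃ q, p = q + 1 := ⟨p - 1, by omega⟩
    rw [pow_succ, mul_assoc, mul_inv_cancel₀ ht]; simp
  have hP : ∏ a : ZMod p, (1 - Polynomial.C a * (Polynomial.X : Polynomial (ZMod p)))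
      = 1 - Polynomial.X ^ (p - 1) := by
    apply IsFractionRing.injective (Polynomial (ZMod p)) K
    simp only [map_prod, map_sub, map_mul, map_one, map_pow]
    exact hK
  let f : ZMod p →+* A := ZMod.castHom (dvd_refl p) A
  have hA := congrArg (Polynomial.eval₂RingHom f x) hP
  simp only [map_prod, map_sub, map_mul, map_one, map_pow, Polynomial.coe_eval₂RingHom,
    Polynomial.eval₂_C, Polynomial.eval₂_X] at hA
  rw [← hA, linProd]
  refine prod_bij (fun i _ => ((i + 1 : ℕ) : ZMod p)) (fun _ _ => mem_univ _) ?_ ?_ ?_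
  · intro i hi j hj hij
    rw [mem_range] at hi hj
    rw [ZMod.natCast_eq_natCast_iff] at hij
    exact Nat.ModEq.eq_of_lt_of_lt (Nat.ModEq.add_right_cancel' 1 hij) hi hj
  · intro a _
    refine ⟨(a - 1).val, mem_range.2 (ZMod.val_lt _), ?_⟩
    simp
  · intro i _
    simp

/-- Modulo `p^M`, the product over a period of length `p^{e+1}` is `(1 - x^{p-1})^{p^e}` as soon
as `e + 1 ≥ 2 M`: the two agree modulo `p` over the period `p^M`, and raising to the power
`p^{e+1-M}` improves the congruence to one modulo `p^M`. -/
lemma pow_dvd_linProd_sub {A : Type*} [CommRing A] (p : ℕ) [Fact p.Prime] (x : A) {M e : ℕ}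
    (hM : 1 ≤ M) (he : 2 * M ≤ e + 1) :
    (p : A) ^ M ∣ linProd x (p ^ (e + 1)) - (1 - x ^ (p - 1)) ^ p ^ e := by
  have h0 : ((p : ℕ) : A) ∣ linProd x (p ^ M) - (1 - x ^ (p - 1)) ^ p ^ (M - 1) := by
    rw [← Ideal.mem_span_singleton, ← Ideal.Quotient.eq, map_linProd, map_pow, map_sub, map_one,
      map_pow]
    set y := Ideal.Quotient.mk (Ideal.span {(p : A)}) x
    have hp0 : ((p : ℕ) : A ⧸ Ideal.span {(p : A)}) = 0 := by
      rw [← map_natCast (Ideal.Quotient.mk _), Ideal.Quotient.eq_zero_iff_mem]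
      exact Ideal.mem_span_singleton_self _
    rcases subsingleton_or_nontrivial (A ⧸ Ideal.span {(p : A)}) with hs | hn
    · exact Subsingleton.elim _ _
    · have : CharP (A ⧸ Ideal.span {(p : A)}) p :=
        ringChar.of_eq (CharP.ringChar_of_prime_eq_zero Fact.out hp0)
      obtain ⟨m, rfl⟩ : ∃ m, M = m + 1 := ⟨M - 1, by omega⟩
      rw [pow_succ', linProd_mul y hp0, linProd_prime]
      simp
  have h1 := dvd_sub_pow_of_dvd_sub h0 (e + 1 - M)
  have h2 : (p : A) ^ M ∣ linProd x (p ^ (e + 1)) - linProd x (p ^ M) ^ p ^ (e + 1 - M) := by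
    rw [← Ideal.mem_span_singleton, ← Ideal.Quotient.eq, map_pow, map_linProd, map_linProd]
    rw [← linProd_mul, ← pow_add]
    · congr 2; omega
    · rw [← map_natCast (Ideal.Quotient.mk _), Ideal.Quotient.eq_zero_iff_mem, Nat.cast_pow]
      exact Ideal.mem_span_singleton_self _
  have h3 := (pow_dvd_pow (p : A) (show M ≤ e + 1 - M + 1 by omega)).trans h1
  have h4 := dvd_add h2 h3
  rw [← pow_mul, ← pow_add] at h4
  rw [show M - 1 + (e + 1 - M) = e by omega] at h4
  simpa using h4

/-- The generating function `∑ S(m + d, d) x^m`. -/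
def stirlingSeries (d : ℕ) : ℤ⟦X⟧ :=
  PowerSeries.mk fun m => (Nat.stirlingSecond (m + d) d : ℤ)

lemma stirlingSeries_mul_linProd (d : ℕ) : stirlingSeries d * linProd X d = 1 := by
  induction d with
  | zero =>
    ext m
    cases m <;> simp [stirlingSeries, linProd, coeff_one]
  | succ d ih =>
    have key : stirlingSeries (d + 1) * (1 - ((d + 1 : ℕ) : ℤ⟦X⟧) * X) = stirlingSeries d := by
      ext m
      rw [mul_sub, mul_one, show stirlingSeries (d + 1) * (((d + 1 : ℕ) : ℤ⟦X⟧) * X)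
        = ((d + 1 : ℕ) : ℤ) • (stirlingSeries (d + 1) * X) by simp; ring]
      rw [map_sub, map_zsmul]
      cases m with
      | zero => simp [stirlingSeries, Nat.stirlingSecond_self]
      | succ m =>
        rw [coeff_succ_mul_X]
        simp only [stirlingSeries, coeff_mk]
        rw [show m + 1 + (d + 1) = m + 1 + d + 1 by ring, Nat.stirlingSecond_succ_succ,
          show m + (d + 1) = m + 1 + d by ring]
        push_cast
        simp
    rw [linProd, prod_range_succ, ← linProd, mul_comm (linProd X d), ← mul_assoc, key, ih]

/-- The generating function `∑ multichoose(B, j) x^{mj}` of `(1 - x^m)^{-B}`. -/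
noncomputable def negPowSeries (m : ℕ) (hm : m ≠ 0) (B : ℕ) : ℤ⟦X⟧ :=
  expand m hm (PowerSeries.mk fun j => (Nat.multichoose B j : ℤ))

lemma negPowSeries_mul (m : ℕ) (hm : m ≠ 0) (B : ℕ) :
    negPowSeries m hm B * (1 - X ^ m) ^ B = 1 := by
  have key : (PowerSeries.mk fun j => (Nat.multichoose B j : ℤ)) * (1 - X) ^ B = 1 := by
    induction B with
    | zero =>
      ext j
      cases j <;> simp [coeff_one]
    | succ B ih =>
      refine Eq.trans ?_ ih
      rw [pow_succ', ← mul_assoc]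
      congr 1
      ext j
      rw [mul_sub, mul_one, map_sub]
      cases j with
      | zero => simp
      | succ j =>
        rw [coeff_succ_mul_X]
        simp [Nat.multichoose_succ_succ]
  have := congrArg (expand m hm) key
  simpa [negPowSeries] using this

/-- The generating function of `m ↦ S(m + p^{e+1} b + d, p^{e+1} b + d)` modulo `p^M`. It is the
inverse of a `linProd`, so the congruence for the latter carries over after multiplication by the
two inverses. -/
lemma pow_dvd_stirlingSeries_sub (p : ℕ) [Fact p.Prime] (hp : p - 1 ≠ 0) (b d : ℕ) {M e : ℕ}
    (hM : 1 ≤ M) (he : 2 * M ≤ e + 1) :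
    (p : ℤ⟦X⟧) ^ M ∣ stirlingSeries (p ^ (e + 1) * b + d)
      - negPowSeries (p - 1) hp (p ^ e * b) * stirlingSeries d := by
  have h1 : (p : ℤ⟦X⟧) ^ M ∣ (1 - X ^ (p - 1)) ^ (p ^ e * b) * linProd X d
      - linProd X (p ^ (e + 1) * b + d) := by
    have h := pow_dvd_linProd_sub p (X : ℤ⟦X⟧) hM he
    rw [← Ideal.mem_span_singleton, ← Ideal.Quotient.eq] at h ⊢
    rw [map_mul, pow_mul, map_pow _ _ b, ← h, map_linProd, map_linProd, map_linProd,
      linProd_mul_add]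
    rw [← map_natCast (Ideal.Quotient.mk _), Ideal.Quotient.eq_zero_iff_mem, Nat.cast_pow]
    exact Ideal.mem_span_singleton.2 (pow_dvd_pow _ (by omega))
  have h2 := stirlingSeries_mul_linProd (p ^ (e + 1) * b + d)
  have h3 := stirlingSeries_mul_linProd d
  have h4 := negPowSeries_mul (p - 1) hp (p ^ e * b)
  refine (h1.mul_left (stirlingSeries (p ^ (e + 1) * b + d) *
    (negPowSeries (p - 1) hp (p ^ e * b) * stirlingSeries d))).trans (dvd_of_eq ?_)
  linear_combination (stirlingSeries (p ^ (e + 1) * b + d)) * (linProd X d * stirlingSeries d * h4)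
    + stirlingSeries (p ^ (e + 1) * b + d) * h3
    - negPowSeries (p - 1) hp (p ^ e * b) * stirlingSeries d * h2

end GeneratingFunctions

/-! ### Coefficients of the generating functions -/

section Coefficients

open PowerSeries Finset

lemma stirling_natCast (n k : ℕ) : stirling n k = Nat.stirlingSecond n k := by
  simp [stirling]

lemma stirling_eq_zero_of_lt {n k : ℤ} (h : n < k) : stirling n k = 0 := by
  unfold stirling
  split_ifs with h'
  · exact Nat.stirlingSecond_eq_zero_of_lt (by omega)
  · rfl

/-- The shift by `X ^ k` produces the first argument `n + d - k`, with the convention for negative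
arguments of `stirling` absorbed into the vanishing of the low coefficients. -/
lemma coeff_X_pow_mul_stirlingSeries (n k d : ℕ) :
    coeff n (X ^ k * stirlingSeries d) = (stirling (n + d - k) d : ℤ) := by
  rw [coeff_X_pow_mul']
  split_ifs with h
  · rw [show (n : ℤ) + d - k = ((n - k + d : ℕ) : ℤ) by omega, stirling_natCast]
    simp [stirlingSeries]
  · rw [stirling_eq_zero_of_lt (by omega)]
    simp

lemma coeff_expand_mul_mul {R : Type*} [CommRing R] (m : ℕ) (hm : m ≠ 0) (f g : R⟦X⟧) (J : ℕ) :
    coeff (m * J) (expand m hm f * g) =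
      ∑ j ∈ range (J + 1), coeff j f * coeff (m * (J - j)) g := by
  rw [coeff_mul, Nat.sum_antidiagonal_eq_sum_range_succ
    (fun i j => coeff i (expand m hm f) * coeff j g)]
  symm
  refine sum_of_injOn (fun j => m * j) ?_ ?_ ?_ ?_
  · intro i _ j _ h
    exact Nat.eq_of_mul_eq_mul_left (Nat.pos_of_ne_zero hm) h
  · intro j hj
    simp only [coe_range, Set.mem_Iio] at hj ⊢
    have := Nat.mul_le_mul_left m (Nat.lt_succ_iff.1 hj)
    omega
  · intro i hi hi'
    have : ¬ m ∣ i := by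
      rintro ⟨j, rfl⟩
      refine hi' ⟨j, ?_, rfl⟩
      simp only [coe_range, Set.mem_Iio, mem_range] at hi ⊢
      have := Nat.le_of_mul_le_mul_left (Nat.lt_succ_iff.1 hi) (Nat.pos_of_ne_zero hm)
      omega
    rw [coeff_expand_of_not_dvd _ _ _ this, zero_mul]
  · intro j _
    simp only [coeff_expand_mul, Nat.mul_sub]

/-- Comparison of coefficients in `pow_dvd_stirlingSeries_sub`. The term `j = p^{e+1} q` is absent
because it carries the factor `S(d - k, d) = 0`. -/
lemma pow_dvd_stirling_sub_sum (p : ℕ) [Fact p.Prime] (b q k d : ℕ) (hk : 1 ≤ k) {M e : ℕ}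
    (hM : 1 ≤ M) (he : 2 * M ≤ e + 1) :
    (p : ℤ) ^ M ∣
      (stirling ((p : ℤ) ^ (e + 1) * (b + (p - 1) * q) + (d - k)) ((p : ℤ) ^ (e + 1) * b + d) : ℤ)
      - ∑ j ∈ range (p ^ (e + 1) * q), (Nat.multichoose (p ^ e * b) j : ℤ) *
          (stirling (((p - 1) * (p ^ (e + 1) * q - j) : ℕ) + d - k) d : ℤ) := by
  have hp1 : 1 < p := (Fact.out : p.Prime).one_lt
  have hp : p - 1 ≠ 0 := by omega
  obtain ⟨g, hg⟩ := (pow_dvd_stirlingSeries_sub p hp b d hM he).mul_left (X ^ k)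
  have h := congrArg (coeff ((p - 1) * (p ^ (e + 1) * q))) hg
  rw [mul_sub, map_sub, coeff_X_pow_mul_stirlingSeries, mul_left_comm (X ^ k),
    negPowSeries, coeff_expand_mul_mul, sum_range_succ] at h
  simp only [coeff_X_pow_mul_stirlingSeries, coeff_mk] at h
  rw [Nat.sub_self, stirling_eq_zero_of_lt (n := ((p - 1) * 0 : ℕ) + d - k) (by simp; omega),
    Nat.cast_zero, mul_zero, add_zero] at h
  have h2 : coeff ((p - 1) * (p ^ (e + 1) * q)) ((p : ℤ⟦X⟧) ^ M * g)
      = (p : ℤ) ^ M * coeff ((p - 1) * (p ^ (e + 1) * q)) g := by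
    rw [show (p : ℤ⟦X⟧) ^ M * g = ((p : ℤ) ^ M) • g by simp [zsmul_eq_mul], map_zsmul, smul_eq_mul]
  refine ⟨_, Eq.trans ?_ (h.trans h2)⟩
  have hn : (p : ℤ) ^ (e + 1) * (b + (p - 1) * q) + (d - k)
      = ((p - 1) * (p ^ (e + 1) * q) : ℕ) + (p ^ (e + 1) * b + d : ℕ) - k := by
    push_cast [Nat.cast_sub hp1.le]
    ring
  have hd : (p : ℤ) ^ (e + 1) * b + d = (p ^ (e + 1) * b + d : ℕ) := by push_cast; rfl
  rw [hn, hd]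

end Coefficients

/-! ### Explicit formulas and partial Stirling numbers -/

section PartialStirling

open Finset

/-- Both the Stirling numbers and their partial analogues come from terms
`(-1)^i binom(k, i) i^n`; this is the step of the recursion in `k` for such terms. -/
lemma mul_choose_succ (k i : ℕ) :
    (i : ℤ) * (k + 1).choose i = (k + 1) * ((k + 1).choose i - k.choose i) := by
  cases i with
  | zero => simp
  | succ i =>
    have h1 := Nat.add_one_mul_choose_eq k i
    have h2 := Nat.choose_succ_succ k i
    have h1' : ((k : ℤ) + 1) * k.choose i = (k + 1).choose (i + 1) * (i + 1) := by exact_mod_cast h1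
    have h2' : ((k + 1).choose (i + 1) : ℤ) = k.choose i + k.choose (i + 1) := by exact_mod_cast h2
    push_cast
    linear_combination -(k + 1 : ℤ) * h2' - h1'

/-- The explicit formula for the Stirling numbers of the second kind. For `n = 0` the term `i = 0`
counts, as `0 ^ 0 = 1`. -/
lemma factorial_mul_stirlingSecond (n k : ℕ) :
    (k.factorial : ℤ) * Nat.stirlingSecond n k =
      (-1) ^ k * ∑ i ∈ range (k + 1), (-1) ^ i * (k.choose i : ℤ) * (i : ℤ) ^ n := by
  induction n generalizing k with
  | zero =>
    have := Int.alternating_sum_range_choose (n := k)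
    cases k with
    | zero => simp
    | succ k => simp [this]
  | succ n ih =>
    cases k with
    | zero => simp
    | succ k =>
      have hext : ∑ i ∈ range (k + 1), (-1) ^ i * (k.choose i : ℤ) * (i : ℤ) ^ n
          = ∑ i ∈ range (k + 1 + 1), (-1) ^ i * (k.choose i : ℤ) * (i : ℤ) ^ n := by
        rw [sum_range_succ _ (k + 1)]; simp
      have hsum : ∑ i ∈ range (k + 1 + 1), (-1) ^ i * ((k + 1).choose i : ℤ) * (i : ℤ) ^ (n + 1)
          = (k + 1) * (∑ i ∈ range (k + 1 + 1), (-1) ^ i * ((k + 1).choose i : ℤ) * (i : ℤ) ^ n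
            - ∑ i ∈ range (k + 1 + 1), (-1) ^ i * (k.choose i : ℤ) * (i : ℤ) ^ n) := by
        rw [← sum_sub_distrib, mul_sum]
        refine sum_congr rfl fun i _ => ?_
        linear_combination (-1) ^ i * (i : ℤ) ^ n * mul_choose_succ k i
      have h1 := ih (k + 1)
      have h2 := ih k
      rw [hext] at h2
      rw [hsum, Nat.stirlingSecond_succ_succ]
      push_cast [Nat.factorial_succ] at h1 h2 ⊢
      linear_combination (k + 1 : ℤ) * h1 + (k + 1 : ℤ) * h2

/-- The partial Stirling numbers satisfy the recursion of the Stirling numbers, at every integer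
exponent: only indices `i` prime to `p`, hence nonzero, occur. -/
lemma partialStirling_succ (p : ℕ) (n : ℤ) (k : ℕ) :
    partialStirling p (n + 1) (k + 1) =
      (k + 1) * partialStirling p n (k + 1) + partialStirling p n k := by
  have hext : ∑ i ∈ (range (k + 1)).filter (fun i => ¬ p ∣ i),
        (-1) ^ i * (k.choose i : ℚ) * (i : ℚ) ^ n
      = ∑ i ∈ (range (k + 1 + 1)).filter (fun i => ¬ p ∣ i),
        (-1) ^ i * (k.choose i : ℚ) * (i : ℚ) ^ n := by
    rw [sum_filter, sum_filter, sum_range_succ _ (k + 1)]; simp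
  have hsum : ∑ i ∈ (range (k + 1 + 1)).filter (fun i => ¬ p ∣ i),
        (-1) ^ i * ((k + 1).choose i : ℚ) * (i : ℚ) ^ (n + 1)
      = (k + 1) * (∑ i ∈ (range (k + 1 + 1)).filter (fun i => ¬ p ∣ i),
        (-1) ^ i * ((k + 1).choose i : ℚ) * (i : ℚ) ^ n
        - ∑ i ∈ (range (k + 1 + 1)).filter (fun i => ¬ p ∣ i),
        (-1) ^ i * (k.choose i : ℚ) * (i : ℚ) ^ n) := by
    rw [← sum_sub_distrib, mul_sum]
    refine sum_congr rfl fun i hi => ?_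
    have hi0 : (i : ℚ) ≠ 0 := by
      rintro h
      rw [Nat.cast_eq_zero] at h
      exact (mem_filter.1 hi).2 (h ▸ dvd_zero p)
    have h : (i : ℚ) * (k + 1).choose i = (k + 1) * ((k + 1).choose i - k.choose i) := by
      exact_mod_cast mul_choose_succ k i
    rw [zpow_add_one₀ hi0]
    linear_combination (-1) ^ i * (i : ℚ) ^ n * h
  have hk : (k.factorial : ℚ) ≠ 0 := by exact_mod_cast k.factorial_ne_zero
  have hk1 : (k + 1 : ℚ) ≠ 0 := by positivity
  rw [partialStirling, partialStirling, partialStirling, hsum, hext, Nat.factorial_succ]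
  push_cast
  field_simp
  ring

lemma partialStirling_zero (p : ℕ) (n : ℤ) : partialStirling p n 0 = 0 := by
  rw [partialStirling, sum_eq_zero, mul_zero]
  intro i hi
  simp only [mem_filter, mem_range] at hi
  obtain rfl : i = 0 := by omega
  simp at hi

/-- `x^{(p-1)m + c}` is `p`-adically close to `x^c` for units `x` and to `0` for non-units. -/
lemma norm_pow_sub_le (p : ℕ) [Fact p.Prime] (x n m r : ℕ) (c : ℤ) (hn : (n : ℤ) = (p - 1) * m + c)
    (hm : p ^ r ∣ m) (hr : r ≤ n) :
    ‖(x : ℚ_[p]) ^ n - if p ∣ x then 0 else (x : ℚ_[p]) ^ c‖ ≤ (p : ℝ) ^ (-r : ℤ) := by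
  split_ifs with hx
  · rw [sub_zero]
    have h : (p ^ r : ℕ) ∣ x ^ n := (pow_dvd_pow p hr).trans (pow_dvd_pow_of_dvd hx n)
    have := (Padic.norm_int_le_pow_iff_dvd (p := p) (x ^ n : ℕ) r).2 (by exact_mod_cast h)
    simpa using this
  · have hx0 : (x : ℚ_[p]) ≠ 0 := by
      intro h
      rw [Nat.cast_eq_zero] at h
      exact hx (h ▸ dvd_zero p)
    have hp1 : 1 < p := (Fact.out : p.Prime).one_lt
    have hnorm : ‖(x : ℚ_[p])‖ = 1 := by
      rw [Padic.norm_natCast_eq_one_iff]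
      exact ((Nat.Prime.coprime_iff_not_dvd Fact.out).2 hx)
    have e1 : (x : ℚ_[p]) ^ n = (x : ℚ_[p]) ^ ((p - 1) * m) * (x : ℚ_[p]) ^ c := by
      rw [← zpow_natCast, ← zpow_natCast, ← zpow_add₀ hx0, hn]
      push_cast [Nat.cast_sub hp1.le]
      rfl
    have hdvd : (p : ℤ) ^ r ∣ (x : ℤ) ^ ((p - 1) * m) - 1 := by
      have hf : (p : ℤ) ∣ (x : ℤ) ^ (p - 1) - 1 := by
        have := Int.ModEq.pow_card_sub_one_eq_one Fact.out (n := (x : ℤ)) (p := p)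
          (by rw [Nat.isCoprime_iff_coprime]
              exact ((Nat.Prime.coprime_iff_not_dvd Fact.out).2 hx).symm)
        exact this.symm.dvd
      have h1 := dvd_sub_pow_of_dvd_sub hf r
      obtain ⟨t, rfl⟩ := hm
      rw [one_pow] at h1
      refine ((pow_dvd_pow (p : ℤ) (Nat.le_succ r)).trans h1).trans ?_
      rw [← mul_assoc, pow_mul, ← pow_mul]
      exact sub_one_dvd_pow_sub_one _ _
    have h2 := (Padic.norm_int_le_pow_iff_dvd (p := p) _ r).2 (by exact_mod_cast hdvd)
    rw [e1, show (x : ℚ_[p]) ^ ((p - 1) * m) * (x : ℚ_[p]) ^ c - (x : ℚ_[p]) ^ c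
      = ((x : ℚ_[p]) ^ ((p - 1) * m) - 1) * (x : ℚ_[p]) ^ c by ring, norm_mul, norm_zpow, hnorm,
      one_zpow, mul_one]
    simpa using h2

/-- If `m > 0` is highly divisible by `p`, the explicit formula for `S((p - 1) m + d - k, d)` is
termwise close to that of `T_p(d - k, d)`. The case `m = 0` has to be excluded, since the terms with
`p ∣ i` are small only for a large exponent. -/
lemma norm_stirling_sub_partialStirling_le (p : ℕ) [Fact p.Prime] (k d r m : ℕ) (hk : 1 ≤ k)
    (hr : k ≤ r) (hm : p ^ r ∣ m) (hm0 : 0 < m) :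
    ‖(stirling (((p - 1) * m : ℕ) + d - k) d : ℚ_[p]) - (partialStirling p (d - k) d : ℚ_[p])‖ ≤
      ‖(d.factorial : ℚ_[p])‖⁻¹ * (p : ℝ) ^ (-r : ℤ) := by
  have hp1 : 1 < p := (Fact.out : p.Prime).one_lt
  -- the exponents `(p - 1) m + d - k` are nonnegative and at least `r`
  have hpm : r + k ≤ (p - 1) * m := by
    have h1 : 2 ^ r ≤ p ^ r := Nat.pow_le_pow_left hp1 r
    have h2 : p ^ r ≤ m := Nat.le_of_dvd hm0 hm
    have h3 : 2 * r ≤ 2 ^ r := by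
      obtain ⟨s, rfl⟩ : ∃ s, r = s + 1 := ⟨r - 1, by omega⟩
      have := Nat.lt_two_pow_self (n := s)
      rw [pow_succ]; omega
    have h4 : 1 * m ≤ (p - 1) * m := Nat.mul_le_mul_right m (by omega)
    omega
  obtain ⟨n, hn⟩ : ∃ n : ℕ, n + k = (p - 1) * m + d := ⟨(p - 1) * m + d - k, by omega⟩
  have hn' : (((p - 1) * m : ℕ) : ℤ) + d - k = (n : ℤ) := by omega
  have hfac : (d.factorial : ℚ_[p]) ≠ 0 := by exact_mod_cast d.factorial_ne_zero
  have hS : (Nat.stirlingSecond n d : ℚ_[p]) = (d.factorial : ℚ_[p])⁻¹ *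
      ((-1) ^ d * ∑ i ∈ range (d + 1), (-1) ^ i * (d.choose i : ℚ_[p]) * (i : ℚ_[p]) ^ n) := by
    rw [eq_inv_mul_iff_mul_eq₀ hfac]
    exact_mod_cast congrArg (Int.cast : ℤ → ℚ_[p]) (factorial_mul_stirlingSecond n d)
  have hT : (partialStirling p (d - k) d : ℚ_[p]) = (d.factorial : ℚ_[p])⁻¹ *
      ((-1) ^ d * ∑ i ∈ range (d + 1), (-1) ^ i * (d.choose i : ℚ_[p]) *
        if p ∣ i then 0 else (i : ℚ_[p]) ^ ((d : ℤ) - k)) := by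
    rw [partialStirling, sum_filter]
    push_cast
    rw [div_mul_eq_mul_div, inv_mul_eq_div]
    congr 2
    refine sum_congr rfl fun i _ => ?_
    split_ifs <;> simp_all
  rw [hn', stirling_natCast, hS, hT, ← mul_sub, ← mul_sub, ← sum_sub_distrib, norm_mul, norm_inv]
  refine mul_le_mul_of_nonneg_left ?_ (by positivity)
  rw [norm_mul, norm_pow, norm_neg, norm_one, one_pow, one_mul]
  refine IsUltrametricDist.norm_sum_le_of_forall_le_of_nonneg (by positivity) fun i _ => ?_
  rw [← mul_sub, norm_mul]
  have h1 : ‖(-1 : ℚ_[p]) ^ i * (d.choose i : ℚ_[p])‖ ≤ 1 := by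
    rw [norm_mul, norm_pow, norm_neg, norm_one, one_pow, one_mul]
    exact_mod_cast Padic.norm_int_le_one (p := p) (d.choose i : ℤ)
  have h2 := norm_pow_sub_le p i n m r ((d : ℤ) - k)
    (by push_cast [Nat.cast_sub hp1.le] at hn'; linarith) hm (by omega)
  calc _ ≤ 1 * _ := mul_le_mul h1 h2 (norm_nonneg _) zero_le_one
    _ = _ := one_mul _

end PartialStirling
/-! ### Binomial coefficients along powers of a prime -/

section Binomials

open Finset

/-- Compare the coefficients of `X^{p^{e+1} b}` in `(1 + X)^{p^{e+1} a}` and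
`(1 + X^p)^{p^e a}`, which are congruent modulo `p^{e+1}`. -/
lemma pow_dvd_choose_sub (p : ℕ) [Fact p.Prime] (a b e : ℕ) :
    (p : ℤ) ^ (e + 1) ∣ ((p ^ (e + 1) * a).choose (p ^ (e + 1) * b) : ℤ)
      - (p ^ e * a).choose (p ^ e * b) := by
  have h0 : ((p : ℕ) : Polynomial ℤ) ∣ (1 + Polynomial.X) ^ p - (1 + Polynomial.X ^ p) := by
    obtain ⟨r, hr⟩ := exists_add_pow_prime_eq (Fact.out : p.Prime) (1 : Polynomial ℤ) Polynomial.X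
    exact ⟨Polynomial.X * r, by rw [hr]; ring⟩
  obtain ⟨g, hg⟩ := (dvd_sub_pow_of_dvd_sub h0 e).trans (sub_dvd_pow_sub_pow _ _ a)
  have hexp : (1 + Polynomial.X ^ p : Polynomial ℤ) = Polynomial.expand ℤ p (1 + Polynomial.X) := by
    simp
  rw [hexp, ← map_pow, ← map_pow, ← pow_mul, ← pow_mul, ← pow_mul] at hg
  have h := congrArg (fun f => Polynomial.coeff f (p ^ (e + 1) * b)) hg
  simp only [Polynomial.coeff_sub] at h
  rw [show p ^ (e + 1) * b = p * (p ^ e * b) by ring,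
    Polynomial.coeff_expand_mul' (Fact.out : p.Prime).pos, Polynomial.coeff_one_add_X_pow,
    Polynomial.coeff_one_add_X_pow] at h
  refine ⟨g.coeff (p * (p ^ e * b)), ?_⟩
  rw [show p ^ (e + 1) * b = p * (p ^ e * b) by ring,
    show p ^ (e + 1) * a = p * (p ^ e * a) by ring]
  refine h.trans ?_
  rw [show (p : Polynomial ℤ) ^ (e + 1) = Polynomial.C ((p : ℤ) ^ (e + 1)) by simp,
    Polynomial.coeff_C_mul]

lemma exists_tendsto_choose (p : ℕ) [Fact p.Prime] (a b : ℕ) :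
    ∃ y : ℚ_[p], Tendsto (fun e : ℕ => ((p ^ e * a).choose (p ^ e * b) : ℚ_[p])) atTop (𝓝 y) := by
  have hp : 1 < (p : ℝ) := by exact_mod_cast (Fact.out : p.Prime).one_lt
  apply cauchySeq_tendsto_of_complete
  refine cauchySeq_of_le_geometric (p : ℝ)⁻¹ 1 (inv_lt_one_of_one_lt₀ hp) fun e => ?_
  have h := (Padic.norm_int_le_pow_iff_dvd (p := p) _ (e + 1)).2
    (by exact_mod_cast pow_dvd_choose_sub p a b e)
  rw [dist_comm, dist_eq_norm, one_mul]
  push_cast at h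
  refine h.trans ?_
  rw [inv_pow, ← zpow_natCast, ← zpow_neg]
  exact zpow_le_zpow_right₀ hp.le (by omega)

/-- Convergence passes from `binom(n, l)` to `binom(n - 1, l) = ((n - l) / n) binom(n, l)`, where
`(n - l) / n = (a - b) / a` does not depend on `e`. -/
lemma exists_tendsto_choose_sub_one (p : ℕ) [Fact p.Prime] {a : ℕ} (b : ℕ) (ha : 1 ≤ a)
    (hba : b ≤ a) :
    ∃ y : ℚ_[p],
      Tendsto (fun e : ℕ => ((p ^ e * a - 1).choose (p ^ e * b) : ℚ_[p])) atTop (𝓝 y) := by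
  obtain ⟨y, hy⟩ := exists_tendsto_choose p a b
  refine ⟨(a - b) / a * y, (hy.const_mul (((a : ℚ_[p]) - b) / a)).congr fun e => ?_⟩
  have hp0 : 0 < p := (Fact.out : p.Prime).pos
  have hpe : 1 ≤ p ^ e * a := Nat.mul_pos (pow_pos hp0 e) ha
  have h := Nat.choose_mul_succ_eq (p ^ e * a - 1) (p ^ e * b)
  rw [Nat.sub_add_cancel hpe, ← Nat.mul_sub] at h
  have h' := congrArg (Nat.cast : ℕ → ℚ_[p]) h
  push_cast [Nat.cast_sub hba] at h'
  have ha0 : (a : ℚ_[p]) ≠ 0 := by exact_mod_cast (by omega : a ≠ 0)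
  have hpe0 : (p : ℚ_[p]) ^ e ≠ 0 := by
    exact_mod_cast pow_ne_zero e hp0.ne'
  rw [div_mul_eq_mul_div, div_eq_iff ha0]
  apply mul_left_cancel₀ hpe0
  linear_combination -h'

/-- `multichoose(B, j) = (B / j) binom(B + j - 1, j - 1)`, so its valuation is at least that of `B`
minus that of `j`. -/
lemma dvd_mul_multichoose (B j : ℕ) : B ∣ j * Nat.multichoose B j := by
  cases j with
  | zero => simp
  | succ j =>
    rw [Nat.multichoose_eq, show B + (j + 1) - 1 = B + j by omega]
    refine ⟨(B + j).choose j, ?_⟩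
    rw [mul_comm, Nat.choose_succ_right_eq, mul_comm, Nat.add_sub_cancel]

lemma norm_multichoose_le (p : ℕ) [Fact p.Prime] (b e r j : ℕ) (hj : ¬ p ^ r ∣ j) :
    ‖(Nat.multichoose (p ^ e * b) j : ℚ_[p])‖ ≤ (p : ℝ) ^ (r : ℤ) * (p : ℝ) ^ (-e : ℤ) := by
  have hp : 0 < (p : ℝ) := by exact_mod_cast (Fact.out : p.Prime).pos
  have h1 : ‖(j : ℚ_[p])‖ * ‖(Nat.multichoose (p ^ e * b) j : ℚ_[p])‖ ≤ (p : ℝ) ^ (-e : ℤ) := by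
    have hd : p ^ e ∣ j * Nat.multichoose (p ^ e * b) j :=
      (dvd_mul_right _ _).trans (dvd_mul_multichoose _ _)
    have := (Padic.norm_int_le_pow_iff_dvd (p := p)
      ((j * Nat.multichoose (p ^ e * b) j : ℕ) : ℤ) e).2 (by exact_mod_cast hd)
    rw [← norm_mul]
    exact_mod_cast this
  have h2 : (p : ℝ) ^ (-r : ℤ) < ‖(j : ℚ_[p])‖ := by
    by_contra! hle
    have := (Padic.norm_int_le_pow_iff_dvd (p := p) (j : ℤ) r).1 (by exact_mod_cast hle)
    exact hj (by exact_mod_cast this)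
  have h3 := (mul_le_mul_of_nonneg_right h2.le (norm_nonneg _)).trans h1
  rw [zpow_neg, inv_mul_le_iff₀ (by positivity)] at h3
  exact h3

lemma sum_range_multichoose_eq_choose (B J : ℕ) (h : B ≠ 0 ∨ J ≠ 0) :
    ∑ j ∈ range J, Nat.multichoose B j = (B + J - 1).choose B := by
  cases J with
  | zero =>
    rw [range_zero, sum_empty, Nat.choose_eq_zero_of_lt]
    omega
  | succ J =>
    rw [Nat.sum_range_multichoose, show B + (J + 1) - 1 = J + B by omega]

end Binomials

/-! ### The limits of the Stirling numbers -/

section StirlingLimit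

open Finset

/-- The error in replacing the Stirling numbers `S(p^{e+1} a + d - k, p^{e+1} b + d)`,
`a = b + (p - 1) q`, by `T_p(d - k, d) binom(p^e (b + p q) - 1, p^e b)`. -/
lemma norm_stirling_sub_mul_choose_le (p : ℕ) [Fact p.Prime] (b q k d : ℕ) (hk : 1 ≤ k)
    (hbq : b ≠ 0 ∨ q ≠ 0) {M e : ℕ} (hM : k ≤ M) (he : 2 * M ≤ e) :
    ‖(stirling ((p : ℤ) ^ (e + 1) * (b + (p - 1) * q) + (d - k)) ((p : ℤ) ^ (e + 1) * b + d) : ℚ_[p])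
      - (partialStirling p (d - k) d : ℚ_[p]) * ((p ^ e * (b + p * q) - 1).choose (p ^ e * b) : ℚ_[p])‖
      ≤ (1 + ‖(d.factorial : ℚ_[p])‖⁻¹ + ‖(partialStirling p (d - k) d : ℚ_[p])‖) *
          (p : ℝ) ^ (-M : ℤ) := by
  have hp : 1 < (p : ℝ) := by exact_mod_cast (Fact.out : p.Prime).one_lt
  have hp0 : 0 < p := (Fact.out : p.Prime).pos
  set T := (partialStirling p (d - k) d : ℚ_[p])
  set K := ‖(d.factorial : ℚ_[p])‖⁻¹
  set ε := (p : ℝ) ^ (-M : ℤ)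
  have hε : 0 ≤ ε := by positivity
  have hK : 0 ≤ K := by positivity
  have hT : 0 ≤ ‖T‖ := norm_nonneg _
  set J := p ^ (e + 1) * q
  set s : ℕ → ℚ_[p] := fun j => (stirling (((p - 1) * (J - j) : ℕ) + d - k) d : ℚ_[p])
  have hbin : ((p ^ e * (b + p * q) - 1).choose (p ^ e * b) : ℚ_[p])
      = ∑ j ∈ range J, (Nat.multichoose (p ^ e * b) j : ℚ_[p]) := by
    rw [← Nat.cast_sum, sum_range_multichoose_eq_choose]
    · congr 3
      simp only [J]; ring
    · have : p ^ e ≠ 0 := by positivity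
      have : p ^ (e + 1) ≠ 0 := by positivity
      simp only [J]
      rcases hbq with h | h
      · left; positivity
      · right; positivity
  have h1 := (Padic.norm_int_le_pow_iff_dvd (p := p) _ M).2
    (pow_dvd_stirling_sub_sum p b q k d hk (hk.trans hM) (by omega : 2 * M ≤ e + 1))
  simp only [Int.cast_sub, Int.cast_sum, Int.cast_mul, Int.cast_natCast] at h1
  have h2 : ‖∑ j ∈ range J, (Nat.multichoose (p ^ e * b) j : ℚ_[p]) * (s j - T)‖
      ≤ (1 + K + ‖T‖) * ε := by
    refine IsUltrametricDist.norm_sum_le_of_forall_le_of_nonneg (by positivity) fun j hj => ?_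
    rw [mem_range] at hj
    rw [norm_mul]
    -- either the Stirling number is close to `T`, or the coefficient is small
    by_cases hd : p ^ M ∣ j
    · have hc : ‖(Nat.multichoose (p ^ e * b) j : ℚ_[p])‖ ≤ 1 := by
        exact_mod_cast Padic.norm_int_le_one (p := p) (Nat.multichoose (p ^ e * b) j : ℤ)
      have hJ : p ^ M ∣ J - j :=
        Nat.dvd_sub ((pow_dvd_pow p (by omega)).trans (dvd_mul_right _ _)) hd
      have hs := norm_stirling_sub_partialStirling_le p k d M (J - j) hk hM hJ (by omega)
      calc _ ≤ 1 * (K * ε) := mul_le_mul hc hs (norm_nonneg _) zero_le_one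
        _ ≤ _ := by nlinarith
    · have hc := norm_multichoose_le p b e M j hd
      have hc' : (p : ℝ) ^ (M : ℤ) * (p : ℝ) ^ (-e : ℤ) ≤ ε := by
        rw [← zpow_add₀ (by positivity)]
        exact zpow_le_zpow_right₀ hp.le (by omega)
      have hs : ‖s j - T‖ ≤ 1 + ‖T‖ := by
        refine (norm_sub_le _ _).trans (add_le_add_left ?_ _)
        have := Padic.norm_int_le_one (p := p)
          (stirling (((p - 1) * (J - j) : ℕ) + d - k) d : ℤ)
        rwa [Int.cast_natCast] at this
      calc _ ≤ ε * (1 + ‖T‖) := mul_le_mul (hc.trans hc') hs (norm_nonneg _) hε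
        _ ≤ _ := by nlinarith
  rw [hbin]
  have hsplit : ∀ x : ℚ_[p], x - T * ∑ j ∈ range J, (Nat.multichoose (p ^ e * b) j : ℚ_[p])
      = (x - ∑ j ∈ range J, (Nat.multichoose (p ^ e * b) j : ℚ_[p]) * s j)
        + ∑ j ∈ range J, (Nat.multichoose (p ^ e * b) j : ℚ_[p]) * (s j - T) := by
    intro x
    simp only [mul_sub, sum_sub_distrib, ← sum_mul]
    ring
  rw [hsplit]
  refine (IsUltrametricDist.norm_add_le_max _ _).trans (max_le ?_ h2)
  refine le_trans ?_ (show ε ≤ (1 + K + ‖T‖) * ε by nlinarith [mul_nonneg hK hε, mul_nonneg hT hε])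
  exact h1

lemma tendsto_stirling (p : ℕ) [Fact p.Prime] (b q k d : ℕ) (hk : 1 ≤ k)
    (hbq : b ≠ 0 ∨ q ≠ 0) {y : ℚ_[p]}
    (hy : Tendsto (fun e : ℕ => ((p ^ e * (b + p * q) - 1).choose (p ^ e * b) : ℚ_[p])) atTop
      (𝓝 y)) :
    Tendsto (fun e : ℕ => (stirling ((p : ℤ) ^ e * (b + (p - 1) * q) + (d - k))
      ((p : ℤ) ^ e * b + d) : ℚ_[p])) atTop (𝓝 ((partialStirling p (d - k) d : ℚ_[p]) * y)) := by
  have hp : 1 < (p : ℝ) := by exact_mod_cast (Fact.out : p.Prime).one_lt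
  -- the Stirling numbers at `e + 1` match the binomial coefficients at `e`
  rw [← tendsto_add_atTop_iff_nat 1]
  have h := hy.const_mul (partialStirling p (d - k) d : ℚ_[p])
  set C := 1 + ‖(d.factorial : ℚ_[p])‖⁻¹ + ‖(partialStirling p (d - k) d : ℚ_[p])‖
  have hlim : Tendsto (fun e : ℕ => C * ((p : ℝ)⁻¹) ^ (e / 2)) atTop (𝓝 0) := by
    rw [← mul_zero C]
    exact ((tendsto_pow_atTop_nhds_zero_of_lt_one (by positivity)
      (inv_lt_one_of_one_lt₀ hp)).comp (Nat.tendsto_div_const_atTop two_ne_zero)).const_mul C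
  have hz := squeeze_zero_norm' (a := fun e : ℕ => C * ((p : ℝ)⁻¹) ^ (e / 2)) (f := fun e : ℕ =>
    (stirling ((p : ℤ) ^ (e + 1) * (b + (p - 1) * q) + (d - k)) ((p : ℤ) ^ (e + 1) * b + d) : ℚ_[p])
      - (partialStirling p (d - k) d : ℚ_[p]) *
        ((p ^ e * (b + p * q) - 1).choose (p ^ e * b) : ℚ_[p])) (t₀ := atTop) ?_ hlim
  · simpa using hz.add h
  · filter_upwards [eventually_ge_atTop (2 * k)] with e he
    have := norm_stirling_sub_mul_choose_le p b q k d hk hbq (M := e / 2) (e := e)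
      (by omega) (by omega)
    rwa [zpow_neg, zpow_natCast, ← inv_pow] at this

end StirlingLimit

/-- A limit in `ℚ_p` of `p`-adic integers is a limit in `ℤ_p`. -/
lemma tendsto_limUnder_of_tendsto_coe (p : ℕ) [Fact p.Prime] {x : ℕ → ℤ_[p]} {y : ℚ_[p]}
    (h : Tendsto (fun e => (x e : ℚ_[p])) atTop (𝓝 y)) :
    Tendsto x atTop (𝓝 (limUnder atTop x)) ∧ ((limUnder atTop x : ℤ_[p]) : ℚ_[p]) = y := by
  have hy : ‖y‖ ≤ 1 := le_of_tendsto h.norm (Eventually.of_forall fun e => (x e).2)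
  have hx : Tendsto x atTop (𝓝 (⟨y, hy⟩ : ℤ_[p])) := tendsto_subtype_rng.2 h
  rw [hx.limUnder_eq]
  exact ⟨hx, rfl⟩

end PadicStirling

theorem proposition3p2 (p : ℕ) [Fact p.Prime] (a b : ℤ)
    (hb : 0 ≤ b) (hba : b ≤ a) (ha : 0 < a) (hab : a ≡ b [ZMOD ((p : ℤ) - 1)]) :
    -- all the limits involved exist
    (∀ k d : ℕ, 1 ≤ k →
      Tendsto (PadicStirling.stirlingSeq p a ((d : ℤ) - k) b d) atTop
        (𝓝 (PadicStirling.Y p a b k d))) ∧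
    Tendsto (PadicStirling.binomSeq p (((p : ℤ) * a - b) / ((p : ℤ) - 1)) (-1) b 0) atTop
      (𝓝 (PadicStirling.binomLim p (((p : ℤ) * a - b) / ((p : ℤ) - 1)) (-1) b 0)) ∧
    -- the value of `Y(1, d)`; the integer division is exact as `a ≡ b` mod `p - 1`
    (∀ d : ℕ, 1 ≤ d →
      (PadicStirling.Y p a b 1 d : ℚ_[p]) =
        (PadicStirling.partialStirling p ((d : ℤ) - 1) d : ℚ_[p]) *
          (PadicStirling.binomLim p (((p : ℤ) * a - b) / ((p : ℤ) - 1)) (-1) b 0 : ℚ_[p])) ∧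
    (∀ k : ℕ, 1 ≤ k → PadicStirling.Y p a b k 0 = 0) ∧
    (∀ k d : ℕ, 2 ≤ k → 1 ≤ d →
      (PadicStirling.Y p a b k d : ℚ_[p]) =
        ((PadicStirling.Y p a b (k - 1) d : ℚ_[p]) - (PadicStirling.Y p a b (k - 1) (d - 1) : ℚ_[p]))
          / (d : ℚ_[p])) := by
  open PadicStirling in
  have hp1 : 1 < (p : ℤ) := by exact_mod_cast (Fact.out : p.Prime).one_lt
  obtain ⟨q', hq'⟩ := hab.symm.dvd
  have hq0 : 0 ≤ q' := by
    by_contra! h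
    nlinarith
  obtain ⟨b, rfl⟩ := Int.eq_ofNat_of_zero_le hb
  obtain ⟨q, rfl⟩ := Int.eq_ofNat_of_zero_le hq0
  obtain rfl : a = b + ((p : ℤ) - 1) * q := by linarith
  have hbq : b ≠ 0 ∨ q ≠ 0 := by
    by_contra! h
    obtain ⟨rfl, rfl⟩ := h
    simp at ha
  have hα : ((p : ℤ) * (b + ((p : ℤ) - 1) * q) - b) / ((p : ℤ) - 1) = b + p * q := by
    apply Int.ediv_eq_of_eq_mul_right (by omega)
    ring
  rw [hα]
  have hp0 : 0 < p := (Fact.out : p.Prime).pos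
  have hα1 : 1 ≤ b + p * q := by
    rcases hbq with h | h
    · omega
    · have : 0 < p * q := by positivity
      omega
  obtain ⟨y, hy⟩ := exists_tendsto_choose_sub_one p (a := b + p * q) b hα1 (by omega)
  have hbin : ∀ e : ℕ, ((binomSeq p (b + p * q) (-1) b 0 e : ℤ_[p]) : ℚ_[p])
      = ((p ^ e * (b + p * q) - 1).choose (p ^ e * b) : ℚ_[p]) := by
    intro e
    have h1 : 1 ≤ p ^ e * (b + p * q) := Nat.mul_pos (pow_pos hp0 e) hα1
    have h2 : (p : ℤ) ^ e * (b + p * q) + -1 = ((p ^ e * (b + p * q) - 1 : ℕ) : ℤ) := by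
      push_cast [Nat.cast_sub h1]; ring
    have h3 : (p : ℤ) ^ e * b + 0 = ((p ^ e * b : ℕ) : ℤ) := by push_cast; ring
    rw [binomSeq, binom, h2, h3, if_pos (Int.natCast_nonneg _), Int.toNat_natCast,
      Ring.choose_natCast]
    simp
  obtain ⟨hB, hBy⟩ := tendsto_limUnder_of_tendsto_coe p
    (x := binomSeq p (b + p * q) (-1) b 0) (hy.congr fun e => (hbin e).symm)
  have hS : ∀ k d : ℕ, 1 ≤ k →
      Tendsto (stirlingSeq p (b + ((p : ℤ) - 1) * q) ((d : ℤ) - k) b d) atTop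
        (𝓝 (Y p (b + ((p : ℤ) - 1) * q) b k d)) ∧
      (Y p (b + ((p : ℤ) - 1) * q) b k d : ℚ_[p]) =
        (partialStirling p ((d : ℤ) - k) d : ℚ_[p]) *
          (binomLim p (b + p * q) (-1) b 0 : ℚ_[p]) := by
    intro k d hk
    rw [binomLim, hBy]
    exact tendsto_limUnder_of_tendsto_coe p
      ((tendsto_stirling p b q k d hk hbq hy).congr fun e => by simp [stirlingSeq])
  refine ⟨fun k d hk => (hS k d hk).1, hB, fun d _ => ?_, fun k hk => ?_, fun k d hk hd => ?_⟩
  · exact_mod_cast (hS 1 d le_rfl).2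
  · have h := (hS k 0 hk).2
    rw [partialStirling_zero] at h
    simpa using h
  · obtain ⟨k, rfl⟩ : ∃ j, k = j + 1 := ⟨k - 1, by omega⟩
    obtain ⟨d, rfl⟩ : ∃ j, d = j + 1 := ⟨d - 1, by omega⟩
    rw [Nat.add_sub_cancel, Nat.add_sub_cancel, (hS _ _ (by omega)).2, (hS k _ (by omega)).2,
      (hS k d (by omega)).2]
    have hd0 : ((d + 1 : ℕ) : ℚ_[p]) ≠ 0 := by exact_mod_cast Nat.succ_ne_zero d
    rw [eq_div_iff hd0]
    have h := congrArg (Rat.cast : ℚ → ℚ_[p]) (partialStirling_succ p ((d : ℤ) - k) d)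
    push_cast at h ⊢
    rw [show (d : ℤ) + 1 - (k + 1) = d - k by ring, show (d : ℤ) + 1 - k = d - k + 1 by ring, h]
    ring
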